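/- **Setting.** Fix an inverse temperature $\beta>0$. Let $S$ be a system of finite dimension $m$ with energy eigenvalues $E^S_1,\dots,E^S_m$ and thermal state $\tau_S=e^{-\beta H_S}/Z_S$, where $Z_S=\operatorname{tr}e^{-\beta H_S}$. Let $C$ be a catalyst whose Hamiltonian $H_C$ has an orthonormal eigenbasis $|1\rangle,|2\rangle,\dots$ with energies $0\le E^C_1\le E^C_2\le\cdots$ and finite partition function $Z_C=\sum_{j\ge1}e^{-\beta E^C_j}<\infty$ (so $E^C_j\to\infty$). For states $\rho,\rho'$ of a system $A$ with Hamiltonian $H_A$, write $\rho\to\rho'$ if $\rho'$ is obtained from $\rho$ by a thermal operation: there are a bath $B$ with Hamiltonian $H_B$ of finite partition function, with thermal state $\tau_B=e^{-\beta H_B}/\operatorname{tr}e^{-\beta H_B}$, and a unitary $U$ on $AB$ with $[U,H_A+H_B]=0$, such that $\rho'=\operatorname{tr}_B\big[U(\rho\otimes\tau_B)U^\dagger\big]$. For density matrices $\rho_S,\rho_S'$ of $S$ put $$D_{1/2}(\rho\|\tau)=-2\log_2\operatorname{tr}\big(\rho^{1/2}\,\tau\,\rho^{1/2}\big)^{1/2},\qquad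 \kappa_2=D_{1/2}(\rho_S'\|\tau_S)-D_{1/2}(\rho_S\|\tau_S),\qquad f(a)=\frac12\,\frac{a^2}{a^2+1}.$$ For a real number $E$ and $\gamma=e^{-\beta/2}$ put $$j(W)=\min\Big\{j\ge1:\ E^C_{j+1}>\frac{E}{1-W}\Big\}\quad(0<W<1),\qquad \varepsilon_C=\sup_{W\in(0,1)}W\,\gamma^{E^C_{j(W)}}.$$ **Lemma.** Let $\rho_S,\rho_S'$ be arbitrary (not necessarily diagonal) density matrices of $S$ with $\kappa_2\ge1$, that is, $2^{\kappa_2}\ge2$. Let $\omega_C=\sum_j\omega_j|j\rangle\langle j|$ and $\omega_C'=\sum_j\omega_j'|j\rangle\langle j|$ be any catalyst states diagonal in the energy eigenbasis such that $\omega_C$ has mean energy $\sum_jE^C_j\omega_j\le E$ and $\omega_C\otimes\rho_S\to\omega_C'\otimes\rho_S'$ on the system $CS$ with Hamiltonian $H_C+H_S$. Then the error $d_{\rm opt}=\frac12\|\omega_C-\omega_C'\|_1=\frac12\sum_j|\omega_j-\omega_j'|$ induced on the catalyst satisfies $$d_{\rm opt}\ \ge\ \frac12\,\frac{f(2^{\kappa_2})^2\,\varepsilon_C^2}{Z_C}.$$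 The right-hand side, which does not depend on the catalyst states, is strictly positive, so thermal embezzling with arbitrary accuracy using a diagonal catalyst of bounded mean energy is not possible. -/

import Mathlib

open scoped MatrixOrder Kronecker ComplexOrder

noncomputable section

/-! Every Hamiltonian is given in an orthonormal basis of energy eigenvectors, indexed by a type `X`
(possibly infinite), so that it is a function `H : X → ℝ`, the energy of each basis vector.
An operator is given by its matrix `Matrix X X ℂ` in that basis. -/

/-- The partition function `Z = tr e^{-βH}`. -/
def partitionFn {X : Type*} (β : ℝ) (H : X → ℝ) : ℝ := ∑' x, Real.exp (-β * H x)

/-- The thermal state `τ = e^{-βH} / tr e^{-βH}`. -/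
def thermalState {X : Type*} [DecidableEq X] (β : ℝ) (H : X → ℝ) : Matrix X X ℂ :=
  Matrix.diagonal fun x => ((Real.exp (-β * H x) / partitionFn β H : ℝ) : ℂ)

/-- The matrix `⟨e_x, U e_y⟩` of a unitary operator `U` on the Hilbert space `ℓ²(X)`. -/
def unitaryMatrix {X : Type*} [DecidableEq X]
    (U : lp (fun _ : X => ℂ) 2 ≃ₗᵢ[ℂ] lp (fun _ : X => ℂ) 2) : Matrix X X ℂ :=
  fun x y => U (lp.single 2 y (1 : ℂ)) x

/-- `[U, H] = 0`, entry by entry in the eigenbasis of `H`. -/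
def CommutesWithHamiltonian {X : Type*} [DecidableEq X]
    (U : lp (fun _ : X => ℂ) 2 ≃ₗᵢ[ℂ] lp (fun _ : X => ℂ) 2) (H : X → ℝ) : Prop :=
  ∀ x y, unitaryMatrix U x y * (H y : ℂ) = (H x : ℂ) * unitaryMatrix U x y

/-- `U T U†`. For a density operator `T` the family summed here is absolutely summable. -/
def evolve {X : Type*} [DecidableEq X]
    (U : lp (fun _ : X => ℂ) 2 ≃ₗᵢ[ℂ] lp (fun _ : X => ℂ) 2) (T : Matrix X X ℂ) : Matrix X X ℂ :=
  fun x x' => ∑' y : X × X, unitaryMatrix U x y.1 * T y.1 y.2 * star (unitaryMatrix U x' y.2)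

/-- The partial trace over the second factor. For a density operator `T` the family summed here is
absolutely summable. -/
def partialTrace {A B : Type*} (T : Matrix (A × B) (A × B) ℂ) : Matrix A A ℂ :=
  fun a a' => ∑' b : B, T (a, b) (a', b)

/-- The Hamiltonian `H_A ⊗ 1 + 1 ⊗ H_B` of two noninteracting systems. -/
def totalHamiltonian {A B : Type*} (HA : A → ℝ) (HB : B → ℝ) : A × B → ℝ :=
  fun x => HA x.1 + HB x.2

/-- `ρ → ρ'` by a thermal operation at inverse temperature `β` on a system with Hamiltonian `HA`:
for some bath `B` of finite partition function and some unitary `U` on `AB` commuting with the total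
Hamiltonian, `ρ' = tr_B (U (ρ ⊗ τ_B) U†)`. -/
def ThermalTransition {A : Type*} [DecidableEq A] (β : ℝ) (HA : A → ℝ) (ρ ρ' : Matrix A A ℂ) :
    Prop :=
  ∃ (B : Type) (_ : Nonempty B) (_ : DecidableEq B) (HB : B → ℝ)
    (U : lp (fun _ : A × B => ℂ) 2 ≃ₗᵢ[ℂ] lp (fun _ : A × B => ℂ) 2),
    Summable (fun b => Real.exp (-β * HB b)) ∧
    CommutesWithHamiltonian U (totalHamiltonian HA HB) ∧
    ρ' = partialTrace (evolve U (ρ ⊗ₖ thermalState β HB))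

/-- Density matrices of a finite-dimensional system. -/
def IsDensityMatrix {S : Type*} [Fintype S] (ρ : Matrix S S ℂ) : Prop :=
  ρ.PosSemidef ∧ ρ.trace = 1

/-- Probability distributions on the energy levels of the catalyst. -/
def IsDistribution (ω : ℕ → ℝ) : Prop := (∀ j, 0 ≤ ω j) ∧ HasSum ω 1

/-- The state `∑ⱼ ωⱼ |j⟩⟨j|`, diagonal in the energy eigenbasis of the catalyst. -/
def diagonalState (ω : ℕ → ℝ) : Matrix ℕ ℕ ℂ := Matrix.diagonal fun j => (ω j : ℂ)

/-- The trace distance `½ ‖ω - ω'‖₁` of two diagonal states. -/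
def diagonalTraceDist (ω ω' : ℕ → ℝ) : ℝ := (1 / 2) * ∑' j, |ω j - ω' j|

/-- The mean energy of the diagonal state `ω` exists (as a convergent sum) and is at most `E`. -/
def MeanEnergyLE (EC : ℕ → ℝ) (ω : ℕ → ℝ) (E : ℝ) : Prop :=
  Summable (fun j => EC j * ω j) ∧ ∑' j, EC j * ω j ≤ E

/-- The Rényi divergence of order one half, in bits:
`D_{1/2}(ρ‖σ) = -2 log₂ tr (ρ^{1/2} σ ρ^{1/2})^{1/2}`. -/
def renyiHalf {S : Type*} [Fintype S] [DecidableEq S] (ρ σ : Matrix S S ℂ) : ℝ :=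
  -2 * Real.logb 2 (CFC.sqrt (CFC.sqrt ρ * σ * CFC.sqrt ρ)).trace.re

/-- `κ₂(ρ, ρ') = D_{1/2}(ρ'‖τ_S) - D_{1/2}(ρ‖τ_S)`. -/
def kappaTwo {S : Type*} [Fintype S] [DecidableEq S] (β : ℝ) (HS : S → ℝ) (ρ ρ' : Matrix S S ℂ) :
    ℝ :=
  renyiHalf ρ' (thermalState β HS) - renyiHalf ρ (thermalState β HS)

/-- `f(a) = ½ a² / (a² + 1)`. -/
def splitConst (a : ℝ) : ℝ := (1 / 2) * (a ^ 2 / (a ^ 2 + 1))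

/-- `j(W)`, the least `j` with `E_{j+1} > E / (1 - W)`; levels are numbered from `0`. For
unbounded energies such a `j` exists. -/
def cutoffLevel (EC : ℕ → ℝ) (E W : ℝ) : ℕ := sInf {j : ℕ | E / (1 - W) < EC (j + 1)}

/-- `ε_C = sup_{0 < W < 1} W γ^{E_{j(W)}}` with `γ = e^{-β/2}`. For nonnegative energies and `β > 0`
the set is bounded above by `1`. -/
def epsC (β : ℝ) (EC : ℕ → ℝ) (E : ℝ) : ℝ :=
  sSup ((fun W : ℝ => W * Real.exp (-β / 2) ^ EC (cutoffLevel EC E W)) '' Set.Ioo 0 1)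

/-- The lower bound `½ f(2^κ₂)² ε_C² / Z_C`. -/
def embezzlingBound {S : Type*} [Fintype S] [DecidableEq S] (β : ℝ) (HS : S → ℝ) (EC : ℕ → ℝ)
    (E : ℝ) (ρ ρ' : Matrix S S ℂ) : ℝ :=
  (1 / 2) * (splitConst ((2 : ℝ) ^ kappaTwo β HS ρ ρ') ^ 2 * epsC β EC E ^ 2 / partitionFn β EC)

end

/-! The proof rests on the root fidelity F(ρ, τ) = tr (√ρ τ √ρ)^{1/2} with the thermal state. It is
multiplicative on product states and does not decrease under thermal operations, so F(ω_C) F(ρ_S) ≤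
F(ω_C') F(ρ_S'). With s = F(ρ_S)/F(ρ_S') this reads s F(ω_C) ≤ F(ω_C'), and 2^κ₂ = s². A large κ₂
thus forces F(ω_C') - F(ω_C) ≥ (s - 1) F(ω_C).

Three scalar facts turn this into the bound. Cauchy-Schwarz gives F(ω_C') - F(ω_C) ≤ √‖ω_C - ω_C'‖₁
(`sq_tsum_sqrt_sub_le`). Markov's inequality puts weight W on the levels up to the cutoff, whence
F(ω_C) ≥ ε_C/√Z_C (`epsC_le_tsum_sqrt`). Finally f(s²) ≤ s - 1 once s² ≥ 2 (`splitConst_sq_le`).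

Monotonicity (`fidelity_le_of_evolve`) is Uhlmann's argument by hand. The input and the Gibbs state
are purified so that their overlap equals the product of the input root fidelities. The unitary
keeps the overlap and, as it conserves energy, the Gibbs state too. The overlap of any two
purifications of the outputs is at most their root fidelity (`norm_tsum_overlap_le`). Only the
blocks diagonal in the catalyst index are needed, and coherences in ρ_S play no special role. -/

/-! ### Overlap and root fidelity for finite matrices. -/

namespace Matrix

/-- The trace of the square root of a positive semidefinite matrix depends only on its
eigenvalues. -/
theorem PosSemidef.trace_sqrt {n : Type*} [Fintype n] [DecidableEq n] {A : Matrix n n ℂ}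
    (hA : A.PosSemidef) :
    (CFC.sqrt A).trace = ∑ i, ((Real.sqrt (hA.isHermitian.eigenvalues i) : ℝ) : ℂ) := by
  rw [CFC.sqrt_eq_real_sqrt A hA.nonneg, cfcₙ_eq_cfc, hA.isHermitian.cfc_eq, IsHermitian.cfc,
    Unitary.conjStarAlgAut_apply, trace_mul_comm, ← mul_assoc]
  simp [trace_diagonal]

/-- `tr √(A†A) = tr √(AA†)`. -/
theorem trace_sqrt_conjTranspose_mul_self {n : Type*} [Fintype n] [DecidableEq n]
    (A : Matrix n n ℂ) : (CFC.sqrt (Aᴴ * A)).trace = (CFC.sqrt (A * Aᴴ)).trace := by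
  have h1 := posSemidef_conjTranspose_mul_self A
  have h2 := posSemidef_self_mul_conjTranspose A
  rw [h1.trace_sqrt, h2.trace_sqrt,
    (h1.isHermitian.eigenvalues_eq_eigenvalues_iff h2.isHermitian).2 (charpoly_mul_comm _ _)]

/-- The sum of the squared norms of the images under `R` of vectors with second moment matrix
`P`. -/
theorem hasSum_sq_norm_mulVec {J S : Type*} [Fintype S] {v : J → S → ℂ} {P : Matrix S S ℂ}
    (hP : ∀ s s', HasSum (fun j => v j s * star (v j s')) (P s s')) (R : Matrix S S ℂ) :
    HasSum (fun j => ∑ s, ‖(R *ᵥ v j) s‖ ^ 2) (R * P * Rᴴ).trace.re := by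
  have h : HasSum (fun j => ∑ s, ∑ t', ∑ t, R s t * (v j t * star (v j t')) * star (R s t'))
      (∑ s, ∑ t', ∑ t, R s t * P t t' * star (R s t')) :=
    hasSum_sum fun s _ => hasSum_sum fun t' _ => hasSum_sum fun t _ =>
      ((hP t t').mul_left _).mul_right _
  have h' := Complex.reCLM.hasSum h
  convert h' using 1
  · funext j
    simp only [Complex.reCLM_apply, Complex.re_sum]
    refine Finset.sum_congr rfl fun s _ => ?_
    have : ((‖(R *ᵥ v j) s‖ ^ 2 : ℝ) : ℂ)
        = ∑ t', ∑ t, R s t * (v j t * star (v j t')) * star (R s t') := by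
      push_cast
      rw [← Complex.mul_conj', mulVec, dotProduct, map_sum, Finset.sum_mul_sum, Finset.sum_comm]
      refine Finset.sum_congr rfl fun _ _ => Finset.sum_congr rfl fun _ _ => ?_
      simp only [map_mul, RCLike.star_def]
      ring
    rw [← Complex.ofReal_re (‖(R *ᵥ v j) s‖ ^ 2), this]
    simp only [Complex.re_sum]
  · simp [trace, mul_apply, Finset.sum_mul]

/-- Since `Rᴴ * R' = 1`, inserting `R` and `R'` does not change the inner products, and AM-GM then
applies termwise. This is the easy half of the variational formula for the fidelity; `R` is left
free in order to be optimised. -/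
theorem norm_tsum_dotProduct_le {J S : Type*} [Fintype S] [DecidableEq S] {v w : J → S → ℂ}
    {P Q R R' : Matrix S S ℂ}
    (hP : ∀ s s', HasSum (fun j => v j s * star (v j s')) (P s s'))
    (hQ : ∀ s s', HasSum (fun j => w j s * star (w j s')) (Q s s')) (hR : Rᴴ * R' = 1) :
    ‖∑' j, ∑ s, star (v j s) * w j s‖
      ≤ ((R * P * Rᴴ).trace.re + (R' * Q * R'ᴴ).trace.re) / 2 := by
  refine tsum_of_norm_bounded
    (((hasSum_sq_norm_mulVec hP R).add (hasSum_sq_norm_mulVec hQ R')).div_const 2) fun j => ?_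
  have h : ∑ s, star (v j s) * w j s = ∑ s, star ((R *ᵥ v j) s) * (R' *ᵥ w j) s := by
    change star (v j) ⬝ᵥ w j = star (R *ᵥ v j) ⬝ᵥ (R' *ᵥ w j)
    rw [star_mulVec, dotProduct_mulVec, vecMul_vecMul, hR, vecMul_one]
  rw [h, ← Finset.sum_add_distrib, Finset.sum_div]
  refine (norm_sum_le _ _).trans (Finset.sum_le_sum fun s _ => ?_)
  rw [norm_mul, norm_star]
  nlinarith [sq_nonneg (‖(R *ᵥ v j) s‖ - ‖(R' *ᵥ w j) s‖)]

/-- The overlap of two purifications is at most the root fidelity. -/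
theorem norm_tsum_dotProduct_le_trace {J S : Type*} [Fintype S] [DecidableEq S] {v w : J → S → ℂ}
    {P N : Matrix S S ℂ} {d : S → ℝ} (hd : ∀ s, 0 < d s)
    (hP : ∀ s s', HasSum (fun j => v j s * star (v j s')) (P s s'))
    (hQ : ∀ s s', HasSum (fun j => w j s * star (w j s'))
      ((diagonal fun s => ((d s ^ 2 : ℝ) : ℂ)) s s'))
    (hN : N.PosSemidef)
    (hNN : N * N = (diagonal fun s => (d s : ℂ)) * P * diagonal fun s => (d s : ℂ)) :
    ‖∑' j, ∑ s, star (v j s) * w j s‖ ≤ N.trace.re := by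
  refine le_of_forall_pos_le_add fun δ hδ => ?_
  -- `N` may be singular, so it is regularised to `N + ε`; half of the extra trace, `ε * card S /
  -- 2`, is the price.
  obtain ⟨ε, hε, hεδ⟩ : ∃ ε : ℝ, 0 < ε ∧ ε * Fintype.card S / 2 ≤ δ := by
    refine ⟨δ / (Fintype.card S + 1), by positivity, ?_⟩
    rw [div_mul_eq_mul_div, div_div, div_le_iff₀ (by positivity)]
    nlinarith [(Nat.cast_nonneg (Fintype.card S) : (0 : ℝ) ≤ _)]
  set D : Matrix S S ℂ := diagonal fun s => (d s : ℂ) with hD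
  set D' : Matrix S S ℂ := diagonal fun s => ((d s)⁻¹ : ℂ) with hD'
  have hDH : Dᴴ = D := by
    rw [hD, diagonal_conjTranspose]; congr 1; funext s; simp
  have hDH' : D'ᴴ = D' := by
    rw [hD', diagonal_conjTranspose]; congr 1; funext s; simp
  have hd0 : ∀ s, (d s : ℂ) ≠ 0 := fun s => by exact_mod_cast (hd s).ne'
  have hDD' : D * D' = 1 := by
    rw [hD, hD', diagonal_mul_diagonal, ← diagonal_one]; congr 1; funext s; simp [hd0 s]
  have hQ' : D' * (diagonal fun s => ((d s ^ 2 : ℝ) : ℂ)) * D' = 1 := by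
    rw [hD', diagonal_mul_diagonal, diagonal_mul_diagonal, ← diagonal_one]
    congr 1; funext s; push_cast; field_simp [hd0 s]
  set M : Matrix S S ℂ := N + (ε : ℂ) • 1 with hM
  have hMpos : M.PosDef := by
    refine PosDef.posSemidef_add hN (PosDef.one.smul ?_)
    exact_mod_cast hε
  have hMstr : IsStrictlyPositive M := isStrictlyPositive_iff_posDef.2 hMpos
  set K := CFC.sqrt M with hK
  -- The optimal pair is `R = K⁻¹ D`, `R' = K D⁻¹` with `K = √(N + ε)`: it balances the two traces,
  -- since both second moments become `N` up to terms of order `ε`.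
  have hKK : K * K = M := CFC.sqrt_mul_sqrt_self M hMstr.nonneg
  have hKu : IsUnit K := hMstr.isUnit_cfcSqrt
  have hKdet : IsUnit K.det := (isUnit_iff_isUnit_det K).1 hKu
  have hKH : Kᴴ = K := (nonneg_iff_posSemidef.1 (CFC.sqrt_nonneg M)).isHermitian
  have hKiH : (K⁻¹)ᴴ = K⁻¹ := by rw [conjTranspose_nonsing_inv, hKH]
  have hR : (K⁻¹ * D)ᴴ * (K * D') = 1 := by
    rw [conjTranspose_mul, hKiH, hDH, mul_assoc, ← mul_assoc K⁻¹, nonsing_inv_mul K hKdet,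
      one_mul, hDD']
  refine (norm_tsum_dotProduct_le hP hQ hR).trans ?_
  have e1 : ((K⁻¹ * D) * P * (K⁻¹ * D)ᴴ) = N - (ε : ℂ) • (K⁻¹ * N * (K⁻¹)ᴴ) := by
    have : N * N = K * N * K - (ε : ℂ) • N := by
      have hc : K * N = N * K := by
        have hN' : N = K * K - (ε : ℂ) • 1 := by rw [hKK, hM]; simp
        rw [hN']
        simp [mul_sub, sub_mul, mul_assoc]
      rw [hc, mul_assoc, hKK, hM]
      simp [mul_add]
    rw [conjTranspose_mul, hKiH, hDH]
    calc K⁻¹ * D * P * (D * K⁻¹) = K⁻¹ * (D * P * D) * K⁻¹ := by simp only [mul_assoc]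
      _ = K⁻¹ * (K * N * K - (ε : ℂ) • N) * K⁻¹ := by rw [← hNN, this]
      _ = (K⁻¹ * K) * N * (K * K⁻¹) - (ε : ℂ) • (K⁻¹ * N * K⁻¹) := by
        simp [mul_sub, sub_mul, mul_assoc]
      _ = _ := by rw [nonsing_inv_mul K hKdet, mul_nonsing_inv K hKdet, one_mul, mul_one]
  have e2 : (K * D') * (diagonal fun s => ((d s ^ 2 : ℝ) : ℂ)) * (K * D')ᴴ = M := by
    rw [conjTranspose_mul, hKH, hDH']
    calc _ = K * (D' * (diagonal fun s => ((d s ^ 2 : ℝ) : ℂ)) * D') * K := by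
          simp only [mul_assoc]
      _ = M := by rw [hQ', mul_one, hKK]
  rw [e1, e2, hM]
  have h3 : 0 ≤ (K⁻¹ * N * (K⁻¹)ᴴ).trace.re :=
    (Complex.le_def.1 (hN.mul_mul_conjTranspose_same K⁻¹).trace_nonneg).1
  simp only [trace_sub, trace_add, trace_smul, trace_one, Complex.sub_re, Complex.add_re,
    smul_eq_mul, Complex.re_ofReal_mul, Complex.natCast_re]
  nlinarith

end Matrix

/-! ### Square-summable families and the overlap bound block by block. -/

theorem summable_mul_of_summable_sq_norm {ι : Type*} {f g : ι → ℂ}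
    (hf : Summable fun i => ‖f i‖ ^ 2) (hg : Summable fun i => ‖g i‖ ^ 2) :
    Summable fun i => f i * g i := by
  refine Summable.of_norm_bounded ((hf.add hg).div_const 2) fun i => ?_
  rw [norm_mul]
  nlinarith [sq_nonneg (‖f i‖ - ‖g i‖)]

theorem summable_mul_star_comp {Z K : Type*} {F : Z → ℂ} (hF : Summable fun z => ‖F z‖ ^ 2)
    {f g : K → Z} (hf : f.Injective) (hg : g.Injective) :
    Summable fun k => F (f k) * star (F (g k)) :=
  summable_mul_of_summable_sq_norm (hF.comp_injective hf)
    (by simpa only [norm_star, Function.comp_def] using hF.comp_injective hg)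

/-- If the blocks of two purified states on `CSB` reduce to `r c • P` and `q c • diag (d ^ 2)` on
`S`, their overlap is at most the classical root fidelity of `r` and `q` times the root fidelity
of `P` and `diag (d ^ 2)`. -/
theorem norm_tsum_overlap_le {C S B I : Type*} [Fintype S] [DecidableEq S]
    {Ψ Φ : I → (C × S) × B → ℂ}
    (hΨ : Summable fun p : I × ((C × S) × B) => ‖Ψ p.1 p.2‖ ^ 2)
    (hΦ : Summable fun p : I × ((C × S) × B) => ‖Φ p.1 p.2‖ ^ 2)
    {r q : C → ℝ} (hr : ∀ c, 0 ≤ r c) (hq : ∀ c, 0 < q c)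
    (hrq : Summable fun c => √(r c * q c))
    {P N : Matrix S S ℂ} {d : S → ℝ} (hd : ∀ s, 0 < d s)
    (hP : ∀ c s s', HasSum (fun j : B × I => Ψ j.2 ((c, s), j.1) * star (Ψ j.2 ((c, s'), j.1)))
      ((r c : ℂ) * P s s'))
    (hQ : ∀ c s s', HasSum (fun j : B × I => Φ j.2 ((c, s), j.1) * star (Φ j.2 ((c, s'), j.1)))
      ((q c : ℂ) * (Matrix.diagonal fun s => ((d s ^ 2 : ℝ) : ℂ)) s s'))
    (hN : N.PosSemidef)
    (hNN : N * N = (Matrix.diagonal fun s => (d s : ℂ)) * P * Matrix.diagonal fun s => (d s : ℂ)) :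
    ‖∑' p : I × ((C × S) × B), star (Ψ p.1 p.2) * Φ p.1 p.2‖
      ≤ (∑' c, √(r c * q c)) * N.trace.re := by
  -- The catalyst level goes outermost; the bath and the purifying index together form the
  -- environment of `S`.
  let e : C × ((B × I) × S) ≃ I × ((C × S) × B) :=
    { toFun := fun p => (p.2.1.2, ((p.1, p.2.2), p.2.1.1))
      invFun := fun p => (p.2.1.1, ((p.2.2, p.1), p.2.1.2))
      left_inv := fun _ => rfl
      right_inv := fun _ => rfl }
  have hsum : Summable fun p : I × ((C × S) × B) => star (Ψ p.1 p.2) * Φ p.1 p.2 :=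
    summable_mul_of_summable_sq_norm (by simpa only [norm_star] using hΨ) hΦ
  have hsum' := (e.summable_iff).2 hsum
  rw [← e.tsum_eq]
  refine (congrArg norm hsum'.tsum_prod).trans_le ?_
  refine tsum_of_norm_bounded (hrq.hasSum.mul_right _) fun c => ?_
  rw [(hsum'.prod_factor c).tsum_prod]
  simp only [Function.comp_apply, tsum_fintype]
  -- The catalyst weight `q c` is absorbed into the diagonal, so that in block `c` the square root
  -- `N` scales by `√(r c * q c)`.
  have hdc : ∀ s, 0 < √(q c) * d s := fun s => mul_pos (Real.sqrt_pos.2 (hq c)) (hd s)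
  have key := Matrix.norm_tsum_dotProduct_le_trace (P := (r c : ℂ) • P)
    (N := (√(r c * q c) : ℂ) • N) hdc
    (v := fun (j : B × I) s => Ψ j.2 ((c, s), j.1)) (w := fun (j : B × I) s => Φ j.2 ((c, s), j.1))
    (fun s s' => by simpa using hP c s s')
    (fun s s' => by
      convert hQ c s s' using 1
      rcases eq_or_ne s s' with rfl | h
      · simp only [Matrix.diagonal_apply_eq, mul_pow, Real.sq_sqrt (hq c).le]
        push_cast; ring
      · simp [Matrix.diagonal_apply_ne _ h])
    (hN.smul (by exact_mod_cast Real.sqrt_nonneg _))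
    (by
      have h1 : (Matrix.diagonal fun s => ((√(q c) * d s : ℝ) : ℂ))
          = (√(q c) : ℂ) • Matrix.diagonal fun s => (d s : ℂ) := by
        rw [← Matrix.diagonal_smul]; congr 1; funext s; simp
      have h2 : (√(r c * q c) : ℂ) * (√(r c * q c) : ℂ) = (√(q c) : ℂ) * r c * (√(q c) : ℂ) := by
        have : (√(q c) : ℝ) * r c * √(q c) = √(r c * q c) * √(r c * q c) := by
          rw [Real.mul_self_sqrt (mul_nonneg (hr c) (hq c).le), mul_right_comm,
            Real.mul_self_sqrt (hq c).le, mul_comm]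
        exact_mod_cast this.symm
      rw [h1]
      simp only [Matrix.smul_mul, Matrix.mul_smul, smul_smul, hNN, h2, Matrix.mul_assoc]
      congr 1; ring)
  refine key.trans_eq ?_
  rw [Matrix.trace_smul, smul_eq_mul, Complex.re_ofReal_mul]

theorem hasSum_sq_norm_apply {X : Type*} (f : lp (fun _ : X => ℂ) 2) :
    HasSum (fun x => ‖f x‖ ^ 2) (‖f‖ ^ 2) := by
  simpa using lp.hasSum_norm (p := 2) (by norm_num) f

theorem summable_sq_norm_of_summable {X I : Type*} {f : I → lp (fun _ : X => ℂ) 2}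
    (hf : Summable fun i => ‖f i‖ ^ 2) : Summable fun p : I × X => ‖f p.1 p.2‖ ^ 2 := by
  refine (summable_prod_of_nonneg fun p => sq_nonneg _).2
    ⟨fun i => (hasSum_sq_norm_apply (f i)).summable, ?_⟩
  simpa only [(hasSum_sq_norm_apply (f _)).tsum_eq] using hf

/-! ### Matrix entries of unitaries on ℓ². -/

section Unitary

variable {X : Type*} [DecidableEq X]
  (U : lp (fun _ : X => ℂ) 2 ≃ₗᵢ[ℂ] lp (fun _ : X => ℂ) 2)

theorem symm_single_apply (x y : X) :
    U.symm (lp.single 2 x (1 : ℂ)) y = star (unitaryMatrix U x y) := by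
  have h1 := lp.inner_single_left (𝕜 := ℂ) y (1 : ℂ) (U.symm (lp.single 2 x (1 : ℂ)))
  have h2 := lp.inner_single_right (𝕜 := ℂ) x (1 : ℂ) (U (lp.single 2 y (1 : ℂ)))
  rw [← U.inner_map_map, U.apply_symm_apply] at h1
  rw [h2] at h1
  simpa [unitaryMatrix] using h1.symm

/-- The rows are, up to conjugation, the images of basis vectors under `U.symm`, so this is
Parseval's identity; it is where the surjectivity of `U` enters. -/
theorem hasSum_unitaryMatrix_row (x x' : X) :
    HasSum (fun y => unitaryMatrix U x y * star (unitaryMatrix U x' y))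
      (if x = x' then 1 else 0) := by
  have h := lp.hasSum_inner (𝕜 := ℂ) (U.symm (lp.single 2 x (1 : ℂ)))
    (U.symm (lp.single 2 x' (1 : ℂ)))
  rw [U.symm.inner_map_map, lp.inner_single_left] at h
  simpa [symm_single_apply, RCLike.inner_apply, lp.single_apply, Pi.single_apply, mul_comm]
    using h

theorem norm_unitaryMatrix_le (x y : X) : ‖unitaryMatrix U x y‖ ≤ 1 := by
  have h := lp.norm_apply_le_norm two_ne_zero (U (lp.single 2 y (1 : ℂ))) x
  rwa [U.norm_map, lp.norm_single (by norm_num), norm_one] at h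

end Unitary

/-! ### Purification of the input state and its evolution. -/

section Purification

open scoped Matrix

/-- The equivalence `((a, b), c) ↦ ((a, c), b)`. -/
def swapRight (X Y Z : Type*) : (X × Y) × Z ≃ (X × Z) × Y where
  toFun p := ((p.1.1, p.2), p.1.2)
  invFun p := ((p.1.1, p.2), p.1.2)
  left_inv _ := rfl
  right_inv _ := rfl

variable {C S B : Type*} [Fintype S] [DecidableEq C] [DecidableEq S] [DecidableEq B]

/-- The vectors `√(ω c p b) ∑ₛ A s k |c, s, b⟩`, whose projectors sum to
`diag ω ⊗ A A† ⊗ diag p`. -/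
noncomputable def purification (ω : C → ℝ) (A : Matrix S S ℂ) (p : B → ℝ) (i : (C × S) × B) :
    lp (fun _ : (C × S) × B => ℂ) 2 :=
  ((√(ω i.1.1 * p i.2) : ℝ) : ℂ) • ∑ s, A s i.1.2 • lp.single 2 ((i.1.1, s), i.2) (1 : ℂ)

theorem tsum_swapRight {C S B : Type*} [Fintype S] {F : (C × S) × B → ℂ} (hF : Summable F) :
    ∑' i, F i = ∑' cb : C × B, ∑ k, F ((cb.1, k), cb.2) := by
  rw [← (swapRight C B S).tsum_eq]
  refine ((swapRight C B S).summable_iff.2 hF).tsum_prod.trans (tsum_congr fun cb => ?_)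
  exact tsum_fintype _

variable {ω : C → ℝ} {p : B → ℝ}

theorem map_purification_apply (A : Matrix S S ℂ)
    (U : lp (fun _ : (C × S) × B => ℂ) 2 ≃ₗᵢ[ℂ] lp (fun _ : (C × S) × B => ℂ) 2)
    (i x : (C × S) × B) :
    U (purification ω A p i) x = ((√(ω i.1.1 * p i.2) : ℝ) : ℂ)
      * ∑ s, A s i.1.2 * unitaryMatrix U x ((i.1.1, s), i.2) := by
  rw [purification, map_smul, map_sum, lp.coeFn_smul, Pi.smul_apply, lp.coeFn_sum,
    Finset.sum_apply, smul_eq_mul]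
  simp only [map_smul, lp.coeFn_smul, Pi.smul_apply, smul_eq_mul, unitaryMatrix]

theorem summable_sq_norm_purification (hω : ∀ c, 0 ≤ ω c) (hp : ∀ b, 0 ≤ p b)
    (hωs : Summable ω) (hps : Summable p) (A : Matrix S S ℂ) :
    Summable fun i => ‖purification ω A p i‖ ^ 2 := by
  have h : Summable fun i : (C × B) × S => (ω i.1.1 * p i.1.2) * (∑ s, ‖A s i.2‖) ^ 2 :=
    (hωs.mul_of_nonneg hps hω hp).mul_of_nonneg
      (Summable.of_finite (f := fun k => (∑ s, ‖A s k‖) ^ 2))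
      (fun i => mul_nonneg (hω _) (hp _)) (fun k => sq_nonneg _)
  refine Summable.of_nonneg_of_le (fun _ => sq_nonneg _) (fun i => ?_)
    ((swapRight C S B).summable_iff.2 h)
  rw [purification, norm_smul, mul_pow, Complex.norm_real, Real.norm_eq_abs, sq_abs,
    Real.sq_sqrt (mul_nonneg (hω _) (hp _))]
  refine mul_le_mul_of_nonneg_left (b := ‖_‖ ^ 2) ?_ (mul_nonneg (hω _) (hp _))
  refine pow_le_pow_left₀ (norm_nonneg _) ((norm_sum_le _ _).trans_eq ?_) 2
  refine Finset.sum_congr rfl fun s _ => ?_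
  rw [norm_smul, lp.norm_single (by norm_num), norm_one, mul_one]
  rfl

theorem summable_sq_norm_map_purification (hω : ∀ c, 0 ≤ ω c) (hp : ∀ b, 0 ≤ p b)
    (hωs : Summable ω) (hps : Summable p) (A : Matrix S S ℂ)
    (U : lp (fun _ : (C × S) × B => ℂ) 2 ≃ₗᵢ[ℂ] lp (fun _ : (C × S) × B => ℂ) 2) :
    Summable fun j : ((C × S) × B) × ((C × S) × B) => ‖U (purification ω A p j.1) j.2‖ ^ 2 :=
  summable_sq_norm_of_summable (f := fun i => U (purification ω A p i))
    (by simpa only [U.norm_map] using summable_sq_norm_purification hω hp hωs hps A)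

theorem map_purification_mul_star (hω : ∀ c, 0 ≤ ω c) (hp : ∀ b, 0 ≤ p b) (A : Matrix S S ℂ)
    (U : lp (fun _ : (C × S) × B => ℂ) 2 ≃ₗᵢ[ℂ] lp (fun _ : (C × S) × B => ℂ) 2)
    (i x x' : (C × S) × B) :
    U (purification ω A p i) x * star (U (purification ω A p i) x')
      = ∑ s, ∑ s', unitaryMatrix U x ((i.1.1, s), i.2) *
          (ω i.1.1 * (A s i.1.2 * star (A s' i.1.2)) * p i.2)
          * star (unitaryMatrix U x' ((i.1.1, s'), i.2)) := by
  have hsq : ((√(ω i.1.1 * p i.2) : ℝ) : ℂ) * ((√(ω i.1.1 * p i.2) : ℝ) : ℂ)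
      = ω i.1.1 * p i.2 := by
    exact_mod_cast Real.mul_self_sqrt (mul_nonneg (hω i.1.1) (hp i.2))
  rw [map_purification_apply, map_purification_apply, star_mul', star_sum, mul_mul_mul_comm,
    Finset.sum_mul_sum, RCLike.star_def, Complex.conj_ofReal]
  simp only [hsq, Finset.mul_sum, map_mul]
  refine Finset.sum_congr rfl fun _ _ => Finset.sum_congr rfl fun _ _ => ?_
  ring

theorem summable_sq_norm_map_purification_apply (hω : ∀ c, 0 ≤ ω c) (hp : ∀ b, 0 ≤ p b)
    (hωs : Summable ω) (hps : Summable p) (A : Matrix S S ℂ)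
    (U : lp (fun _ : (C × S) × B => ℂ) 2 ≃ₗᵢ[ℂ] lp (fun _ : (C × S) × B => ℂ) 2)
    (x x' : (C × S) × B) :
    Summable fun i => U (purification ω A p i) x * star (U (purification ω A p i) x') :=
  summable_mul_star_comp
    (F := fun z : ((C × S) × B) × ((C × S) × B) => U (purification ω A p z.1) z.2)
    (summable_sq_norm_map_purification hω hp hωs hps A U)
    (f := fun i => (i, x)) (g := fun i => (i, x'))
    (Prod.mk_left_injective x) (Prod.mk_left_injective x')

/-- For fixed `c` and `b`, summing the rank-one terms over the purifying index of `S` reassembles `A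
* Aᴴ`. -/
theorem evolve_eq_tsum_purification (hω : ∀ c, 0 ≤ ω c) (hp : ∀ b, 0 ≤ p b)
    (hωs : Summable ω) (hps : Summable p) (A : Matrix S S ℂ)
    (U : lp (fun _ : (C × S) × B => ℂ) 2 ≃ₗᵢ[ℂ] lp (fun _ : (C × S) × B => ℂ) 2)
    (x x' : (C × S) × B) :
    evolve U ((Matrix.diagonal (fun c => (ω c : ℂ)) ⊗ₖ (A * Aᴴ)) ⊗ₖ
        Matrix.diagonal fun b => (p b : ℂ)) x x'
      = ∑' i, U (purification ω A p i) x * star (U (purification ω A p i) x') := by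
  let g : (C × B) × (S × S) → ((C × S) × B) × ((C × S) × B) :=
    fun z => (((z.1.1, z.2.1), z.1.2), ((z.1.1, z.2.2), z.1.2))
  have hg : Function.Injective g := by
    rintro ⟨⟨c, b⟩, s, t⟩ ⟨⟨c', b'⟩, s', t'⟩ h
    simp only [g, Prod.mk.injEq] at h ⊢
    tauto
  unfold evolve
  -- The state is diagonal in `c` and `b`, so only index pairs in the range of `g` contribute.
  rw [← hg.tsum_eq]
  swap
  · rintro ⟨⟨⟨c, s⟩, b⟩, ⟨⟨c', s'⟩, b'⟩⟩ hz
    by_cases hc : c = c'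
    · by_cases hb : b = b'
      · subst hc hb
        exact ⟨((c, b), (s, s')), rfl⟩
      · simp [Matrix.kroneckerMap_apply, Matrix.diagonal_apply_ne _ hb] at hz
    · simp [Matrix.kroneckerMap_apply, Matrix.diagonal_apply_ne _ hc] at hz
  have hS : Summable fun z : (C × B) × (S × S) => (ω z.1.1 * p z.1.2) * ‖(A * Aᴴ) z.2.1 z.2.2‖ :=
    (hωs.mul_of_nonneg hps hω hp).mul_of_nonneg
      (Summable.of_finite (f := fun z : S × S => ‖(A * Aᴴ) z.1 z.2‖))
      (fun i => mul_nonneg (hω _) (hp _)) (fun k => norm_nonneg _)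
  have hsum : Summable fun z : (C × B) × (S × S) => unitaryMatrix U x (g z).1 *
      ((Matrix.diagonal (fun c => (ω c : ℂ)) ⊗ₖ (A * Aᴴ)) ⊗ₖ
        Matrix.diagonal fun b => (p b : ℂ)) (g z).1 (g z).2 *
      star (unitaryMatrix U x' (g z).2) := by
    refine Summable.of_norm_bounded hS fun z => ?_
    simp only [g, Matrix.kroneckerMap_apply, Matrix.diagonal_apply_eq, norm_mul, norm_star,
      Complex.norm_real, Real.norm_eq_abs, abs_of_nonneg (hω _), abs_of_nonneg (hp _)]
    calc _ ≤ 1 * (ω z.1.1 * ‖(A * Aᴴ) z.2.1 z.2.2‖ * p z.1.2) * 1 := by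
          have := hω z.1.1
          have := hp z.1.2
          gcongr <;> exact norm_unitaryMatrix_le _ _ _
      _ = _ := by ring
  rw [tsum_swapRight (summable_sq_norm_map_purification_apply hω hp hωs hps A U x x')]
  refine hsum.tsum_prod.trans (tsum_congr fun cb => ?_)
  rw [tsum_fintype, Fintype.sum_prod_type]
  simp only [map_purification_mul_star hω hp]
  symm
  rw [Finset.sum_comm]
  refine Finset.sum_congr rfl fun s _ => ?_
  rw [Finset.sum_comm]
  refine Finset.sum_congr rfl fun s' _ => ?_
  simp only [g, Matrix.kroneckerMap_apply, Matrix.diagonal_apply_eq, Matrix.mul_apply,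
    Matrix.conjTranspose_apply, Finset.mul_sum, Finset.sum_mul]

end Purification

/-! ### Gibbs weights and reduced blocks. -/

section Gibbs

variable {X : Type*} {β : ℝ} {H : X → ℝ}

theorem partitionFn_pos [Nonempty X] (h : Summable fun x => Real.exp (-β * H x)) :
    0 < partitionFn β H :=
  h.tsum_pos (fun _ => (Real.exp_pos _).le) (Classical.arbitrary X) (Real.exp_pos _)

theorem gibbs_pos (h : Summable fun x => Real.exp (-β * H x)) (x : X) :
    0 < Real.exp (-β * H x) / partitionFn β H :=
  have : Nonempty X := ⟨x⟩
  div_pos (Real.exp_pos _) (partitionFn_pos h)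

theorem hasSum_gibbs [Nonempty X] (h : Summable fun x => Real.exp (-β * H x)) :
    HasSum (fun x => Real.exp (-β * H x) / partitionFn β H) 1 := by
  rw [← div_self (partitionFn_pos h).ne']
  exact h.hasSum.div_const _

end Gibbs

theorem hasSum_block {C S B I : Type*} {Ψ : I → (C × S) × B → ℂ}
    (hΨ : Summable fun p : I × ((C × S) × B) => ‖Ψ p.1 p.2‖ ^ 2) (c : C) (s s' : S) :
    HasSum (fun j : B × I => Ψ j.2 ((c, s), j.1) * star (Ψ j.2 ((c, s'), j.1)))
      (∑' b, ∑' i, Ψ i ((c, s), b) * star (Ψ i ((c, s'), b))) := by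
  have h : Summable fun j : B × I => Ψ j.2 ((c, s), j.1) * star (Ψ j.2 ((c, s'), j.1)) :=
    summable_mul_star_comp (F := fun z : I × ((C × S) × B) => Ψ z.1 z.2) hΨ
      (f := fun j : B × I => (j.2, ((c, s), j.1))) (g := fun j : B × I => (j.2, ((c, s'), j.1)))
      (fun _ _ h => by simp only [Prod.mk.injEq] at h; exact Prod.ext h.2.2 h.1)
      (fun _ _ h => by simp only [Prod.mk.injEq] at h; exact Prod.ext h.2.2 h.1)
  have h2 := h.hasSum
  rwa [h.tsum_prod] at h2

/-! ### Invariance of the overlap and of the Gibbs state. -/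

section Overlap

open scoped Matrix

variable {C S B : Type*} [Fintype S] [DecidableEq C] [DecidableEq S] [DecidableEq B]

theorem purification_diagonal (q : C → ℝ) (d : S → ℝ) (p : B → ℝ) (i : (C × S) × B) :
    purification q (Matrix.diagonal fun s => (d s : ℂ)) p i
      = ((√(q i.1.1 * p i.2) * d i.1.2 : ℝ) : ℂ) • lp.single 2 i (1 : ℂ) := by
  rw [purification, Finset.sum_eq_single i.1.2, Matrix.diagonal_apply_eq, smul_smul]
  · push_cast; rfl
  · intro s _ hs
    rw [Matrix.diagonal_apply_ne _ hs, zero_smul]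
  · simp

theorem purification_apply_self (ω : C → ℝ) (A : Matrix S S ℂ) (p : B → ℝ) (i : (C × S) × B) :
    purification ω A p i i = ((√(ω i.1.1 * p i.2) : ℝ) : ℂ) * A i.1.2 i.1.2 := by
  have h := map_purification_apply (ω := ω) (p := p) A (LinearIsometryEquiv.refl ℂ _) i i
  rw [LinearIsometryEquiv.coe_refl, id_eq, Finset.sum_eq_single i.1.2] at h
  · simpa [unitaryMatrix] using h
  · intro s _ hs
    have : i ≠ ((i.1.1, s), i.2) := fun h => hs (congrArg (fun z => z.1.2) h).symm
    simp [unitaryMatrix, lp.single_apply, this]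
  · simp

theorem inner_purification_diagonal {ω q : C → ℝ} {p : B → ℝ} (hω : ∀ c, 0 ≤ ω c)
    (hq : ∀ c, 0 ≤ q c) (hp : ∀ b, 0 ≤ p b) (A : Matrix S S ℂ) (d : S → ℝ) (i : (C × S) × B) :
    inner ℂ (purification ω A p i) (purification q (Matrix.diagonal fun s => (d s : ℂ)) p i)
      = ((√(ω i.1.1 * q i.1.1) * p i.2 : ℝ) : ℂ) * (d i.1.2 * star (A i.1.2 i.1.2)) := by
  rw [purification_diagonal, inner_smul_right, lp.inner_single_right, purification_apply_self]
  have h : √(q i.1.1 * p i.2) * √(ω i.1.1 * p i.2) = √(ω i.1.1 * q i.1.1) * p i.2 := by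
    rw [← Real.sqrt_mul (mul_nonneg (hq _) (hp _)),
      show q i.1.1 * p i.2 * (ω i.1.1 * p i.2) = (ω i.1.1 * q i.1.1) * (p i.2) ^ 2 by ring,
      Real.sqrt_mul (mul_nonneg (hω _) (hq _)), Real.sqrt_sq (hp _)]
  rw [← h]
  simp
  ring

/-- The overlap of the purifications is preserved by the unitary. -/
theorem tsum_overlap_eq {ω q : C → ℝ} {p : B → ℝ} (hω : ∀ c, 0 ≤ ω c)
    (hq : ∀ c, 0 ≤ q c) (hp : ∀ b, 0 ≤ p b) (hωs : Summable ω) (hqs : Summable q)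
    (hωq : Summable fun c => √(ω c * q c)) (hps : HasSum p 1) (A : Matrix S S ℂ) (d : S → ℝ)
    (U : lp (fun _ : (C × S) × B => ℂ) 2 ≃ₗᵢ[ℂ] lp (fun _ : (C × S) × B => ℂ) 2) :
    ∑' z : ((C × S) × B) × ((C × S) × B), star (U (purification ω A p z.1) z.2)
        * U (purification q (Matrix.diagonal fun s => (d s : ℂ)) p z.1) z.2
      = ((∑' c, √(ω c * q c) : ℝ) : ℂ) * ∑ s, d s * star (A s s) := by
  have hΨ := summable_sq_norm_map_purification hω hp hωs hps.summable A U
  have hΦ := summable_sq_norm_map_purification hq hp hqs hps.summable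
    (Matrix.diagonal fun s => (d s : ℂ)) U
  have hsum : Summable fun z : ((C × S) × B) × ((C × S) × B) =>
      star (U (purification ω A p z.1) z.2)
        * U (purification q (Matrix.diagonal fun s => (d s : ℂ)) p z.1) z.2 :=
    summable_mul_of_summable_sq_norm (by simpa only [norm_star] using hΨ) hΦ
  have hin : ∀ i, ∑' x, star (U (purification ω A p i) x)
        * U (purification q (Matrix.diagonal fun s => (d s : ℂ)) p i) x
      = ((√(ω i.1.1 * q i.1.1) * p i.2 : ℝ) : ℂ) * (d i.1.2 * star (A i.1.2 i.1.2)) := fun i => by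
    rw [← inner_purification_diagonal hω hq hp, ← U.inner_map_map, lp.inner_eq_tsum]
    exact tsum_congr fun x => mul_comm _ _
  have hsum1 := hsum.prod
  rw [hsum.tsum_prod]
  simp only [hin] at hsum1 ⊢
  rw [tsum_swapRight hsum1]
  simp only [← Finset.mul_sum]
  rw [tsum_mul_right]
  congr 1
  have h := (hωq.hasSum.mul hps (hωq.mul_of_nonneg hps.summable (fun _ => Real.sqrt_nonneg _) hp))
  rw [← Complex.ofReal_tsum, h.tsum_eq, mul_one]

end Overlap

/-- A nonzero entry of `U` joins only levels of equal energy, so `U` commutes with every function of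
the Hamiltonian. -/
theorem commutesWithHamiltonian_mul {X : Type*} [DecidableEq X]
    {U : lp (fun _ : X => ℂ) 2 ≃ₗᵢ[ℂ] lp (fun _ : X => ℂ) 2} {H : X → ℝ}
    (hU : CommutesWithHamiltonian U H) (φ : ℝ → ℝ) (x y : X) :
    (φ (H y) : ℂ) * unitaryMatrix U x y = φ (H x) * unitaryMatrix U x y := by
  by_cases h : unitaryMatrix U x y = 0
  · simp [h]
  · have h1 := hU x y
    rw [mul_comm] at h1
    rw [Complex.ofReal_injective (mul_right_cancel₀ h h1)]

/-- A unitary commuting with the Hamiltonian leaves the Gibbs weights invariant. -/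
theorem hasSum_gibbs_purification {C S B : Type*} [Fintype S] [DecidableEq C] [DecidableEq S]
    [DecidableEq B] {β : ℝ} {HC : C → ℝ} {HS : S → ℝ} {HB : B → ℝ} {zC zS zB : ℝ}
    (hC : 0 ≤ zC) (hS : 0 ≤ zS) (hB : 0 ≤ zB)
    {U : lp (fun _ : (C × S) × B => ℂ) 2 ≃ₗᵢ[ℂ] lp (fun _ : (C × S) × B => ℂ) 2}
    (hU : CommutesWithHamiltonian U (totalHamiltonian (totalHamiltonian HC HS) HB))
    (x x' : (C × S) × B) :
    HasSum (fun i =>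
      U (purification (fun c => Real.exp (-β * HC c) / zC)
        (Matrix.diagonal fun s => ((√(Real.exp (-β * HS s) / zS) : ℝ) : ℂ))
        (fun b => Real.exp (-β * HB b) / zB) i) x *
      star (U (purification (fun c => Real.exp (-β * HC c) / zC)
        (Matrix.diagonal fun s => ((√(Real.exp (-β * HS s) / zS) : ℝ) : ℂ))
        (fun b => Real.exp (-β * HB b) / zB) i) x'))
      (((Real.exp (-β * HC x.1.1) / zC) * (Real.exp (-β * HS x.1.2) / zS)
        * (Real.exp (-β * HB x.2) / zB) : ℝ) * if x = x' then 1 else 0) := by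
  have h0 : HasSum (fun i => (((Real.exp (-β * HC x.1.1) / zC) * (Real.exp (-β * HS x.1.2) / zS)
      * (Real.exp (-β * HB x.2) / zB) : ℝ) : ℂ) * (unitaryMatrix U x i
        * star (unitaryMatrix U x' i))) _ := (hasSum_unitaryMatrix_row U x x').mul_left _
  convert h0 using 1
  funext i
  -- With `φ` the Boltzmann weight, the weight moves from the summation index `i` to `x`, and
  -- orthonormality of the rows finishes.
  have h := commutesWithHamiltonian_mul hU (fun E => Real.exp (-β * E) / (zC * zS * zB)) x i
  have hexp : ∀ y : (C × S) × B, (Real.exp (-β * HC y.1.1) / zC) * (Real.exp (-β * HS y.1.2) / zS)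
      * (Real.exp (-β * HB y.2) / zB)
      = Real.exp (-β * totalHamiltonian (totalHamiltonian HC HS) HB y) / (zC * zS * zB) := by
    intro y
    rw [totalHamiltonian, totalHamiltonian, mul_add, mul_add, Real.exp_add, Real.exp_add]
    simp only [div_eq_mul_inv, mul_inv]
    ring
  simp only [← hexp] at h
  rw [← mul_assoc, ← h, purification_diagonal, map_smul, lp.coeFn_smul, Pi.smul_apply,
    Pi.smul_apply, smul_eq_mul, smul_eq_mul]
  change _ * unitaryMatrix U x i * star (_ * unitaryMatrix U x' i) = _
  have hsq : (√(Real.exp (-β * HC i.1.1) / zC * (Real.exp (-β * HB i.2) / zB))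
        * √(Real.exp (-β * HS i.1.2) / zS))
      * (√(Real.exp (-β * HC i.1.1) / zC * (Real.exp (-β * HB i.2) / zB))
        * √(Real.exp (-β * HS i.1.2) / zS))
      = (Real.exp (-β * HC i.1.1) / zC) * (Real.exp (-β * HS i.1.2) / zS)
      * (Real.exp (-β * HB i.2) / zB) := by
    rw [mul_mul_mul_comm, Real.mul_self_sqrt (by positivity), Real.mul_self_sqrt (by positivity)]
    ring
  rw [← hsq, star_mul', RCLike.star_def, Complex.conj_ofReal]
  push_cast
  ring

/-! ### Monotonicity of the root fidelity. -/

/-- A positive semidefinite square root `N` of `D ρ D` yields the factorization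
`ρ = (D⁻¹ N) (D⁻¹ N)†`. -/
theorem Matrix.eq_mul_conjTranspose_of_sq_eq {S : Type*} [Fintype S] [DecidableEq S] {d : S → ℝ}
    (hd : ∀ s, 0 < d s) {ρ N : Matrix S S ℂ} (hN : N.PosSemidef)
    (hNN : N * N = (Matrix.diagonal fun s => (d s : ℂ)) * ρ * Matrix.diagonal fun s => (d s : ℂ)) :
    ρ = (Matrix.diagonal (fun s => ((d s)⁻¹ : ℂ)) * N) *
        Matrix.conjTranspose (Matrix.diagonal (fun s => ((d s)⁻¹ : ℂ)) * N) ∧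
      ∑ s, d s * star ((Matrix.diagonal (fun s => ((d s)⁻¹ : ℂ)) * N) s s) = N.trace := by
  set D : Matrix S S ℂ := Matrix.diagonal fun s => (d s : ℂ) with hD
  set D' : Matrix S S ℂ := Matrix.diagonal fun s => ((d s)⁻¹ : ℂ) with hD'
  have hd0 : ∀ s, (d s : ℂ) ≠ 0 := fun s => by exact_mod_cast (hd s).ne'
  have hDD' : D' * D = 1 := by
    rw [hD', hD, Matrix.diagonal_mul_diagonal, ← Matrix.diagonal_one]
    congr 1; funext s; simp [hd0 s]
  have hD'D : D * D' = 1 := by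
    rw [hD', hD, Matrix.diagonal_mul_diagonal, ← Matrix.diagonal_one]
    congr 1; funext s; simp [hd0 s]
  have hDH' : Matrix.conjTranspose D' = D' := by
    rw [hD', Matrix.diagonal_conjTranspose]; congr 1; funext s; simp
  constructor
  · rw [Matrix.conjTranspose_mul, hN.isHermitian, hDH']
    calc ρ = (D' * D) * ρ * (D * D') := by rw [hDD', hD'D, one_mul, mul_one]
      _ = D' * (D * ρ * D) * D' := by simp only [mul_assoc]
      _ = _ := by rw [← hNN]; simp only [mul_assoc]
  · refine Finset.sum_congr rfl fun s _ => ?_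
    have h1 : star (N s s) = N s s := by
      conv_rhs => rw [← hN.isHermitian]
      rfl
    rw [hD', Matrix.diagonal_mul, star_mul', h1, Matrix.diag_apply]
    simp [hd0 s]

/-- A unitary that preserves the blocks of the reference state `q ⊗ diag (d ^ 2) ⊗ p` cannot
decrease the root fidelity with it. -/
theorem fidelity_le_of_evolve {C S B : Type*} [Fintype S] [DecidableEq C] [DecidableEq S]
    [DecidableEq B] {r r' q : C → ℝ} {p : B → ℝ} {d : S → ℝ}
    (hr : ∀ c, 0 ≤ r c) (hrs : Summable r) (hr' : ∀ c, 0 ≤ r' c)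
    (hq : ∀ c, 0 < q c) (hqs : Summable q) (hp : ∀ b, 0 ≤ p b) (hps : HasSum p 1)
    (hd : ∀ s, 0 < d s) (hrq : Summable fun c => √(r c * q c))
    (hrq' : Summable fun c => √(r' c * q c)) {ρ ρ' N N' : Matrix S S ℂ}
    (hN : N.PosSemidef) (hN' : N'.PosSemidef)
    (hNN : N * N = (Matrix.diagonal fun s => (d s : ℂ)) * ρ * Matrix.diagonal fun s => (d s : ℂ))
    (hNN' : N' * N' =
      (Matrix.diagonal fun s => (d s : ℂ)) * ρ' * Matrix.diagonal fun s => (d s : ℂ))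
    (U : lp (fun _ : (C × S) × B => ℂ) 2 ≃ₗᵢ[ℂ] lp (fun _ : (C × S) × B => ℂ) 2)
    (hρ' : ∀ c s s', (r' c : ℂ) * ρ' s s' = partialTrace (evolve U
      ((Matrix.diagonal (fun c => (r c : ℂ)) ⊗ₖ ρ) ⊗ₖ Matrix.diagonal fun b => (p b : ℂ)))
      (c, s) (c, s'))
    (hG : ∀ c s s', (q c : ℂ) * (Matrix.diagonal fun s => ((d s ^ 2 : ℝ) : ℂ)) s s' =
      ∑' b, ∑' i, U (purification q (Matrix.diagonal fun s => (d s : ℂ)) p i) ((c, s), b) *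
        star (U (purification q (Matrix.diagonal fun s => (d s : ℂ)) p i) ((c, s'), b))) :
    (∑' c, √(r c * q c)) * N.trace.re ≤ (∑' c, √(r' c * q c)) * N'.trace.re := by
  obtain ⟨hA, htr⟩ := Matrix.eq_mul_conjTranspose_of_sq_eq hd hN hNN
  -- This factor of `ρ` makes the purification optimal: its overlap with that of the reference state
  -- on `S` is exactly `N.trace`.
  set A := Matrix.diagonal (fun s => ((d s)⁻¹ : ℂ)) * N
  have hΨ := summable_sq_norm_map_purification hr hp hrs hps.summable A U
  have hΦ := summable_sq_norm_map_purification (fun c => (hq c).le) hp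
    hqs hps.summable (Matrix.diagonal fun s => (d s : ℂ)) U
  have hP : ∀ c s s', HasSum (fun j : B × ((C × S) × B) =>
      U (purification r A p j.2) ((c, s), j.1) * star (U (purification r A p j.2) ((c, s'), j.1)))
      ((r' c : ℂ) * ρ' s s') := fun c s s' => by
    have h := hasSum_block (Ψ := fun i x => U (purification r A p i) x) hΨ c s s'
    rwa [← tsum_congr fun b => evolve_eq_tsum_purification hr hp hrs hps.summable A U
      ((c, s), b) ((c, s'), b), ← hA, ← partialTrace, ← hρ'] at h
  have hQ : ∀ c s s', HasSum (fun j : B × ((C × S) × B) =>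
      U (purification q (Matrix.diagonal fun s => (d s : ℂ)) p j.2) ((c, s), j.1) *
      star (U (purification q (Matrix.diagonal fun s => (d s : ℂ)) p j.2) ((c, s'), j.1)))
      ((q c : ℂ) * (Matrix.diagonal fun s => ((d s ^ 2 : ℝ) : ℂ)) s s') := fun c s s' => by
    rw [hG]
    exact hasSum_block
      (Ψ := fun i x => U (purification q (Matrix.diagonal fun s => (d s : ℂ)) p i) x) hΦ c s s'
  have key := norm_tsum_overlap_le (Ψ := fun i x => U (purification r A p i) x)
    (Φ := fun i x => U (purification q (Matrix.diagonal fun s => (d s : ℂ)) p i) x)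
    hΨ hΦ hr' hq hrq' hd hP hQ hN' hNN'
  rw [tsum_overlap_eq hr (fun c => (hq c).le) hp hrs hqs hrq hps, htr] at key
  refine le_trans ?_ key
  rw [← Complex.re_ofReal_mul]
  exact Complex.re_le_norm _

theorem IsDistribution.summable_sqrt_mul {r q : ℕ → ℝ} (hr : IsDistribution r)
    (hq : ∀ c, 0 ≤ q c) (hqs : Summable q) : Summable fun c => √(r c * q c) :=
  Summable.of_nonneg_of_le (fun _ => Real.sqrt_nonneg _)
    (fun c => Real.sqrt_le_iff.2 ⟨add_nonneg (hr.1 c) (hq c), by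
      nlinarith [hr.1 c, hq c, mul_nonneg (hr.1 c) (hq c)]⟩)
    (hr.2.summable.add hqs)

/-- Monotonicity of the root fidelity with the thermal state under thermal operations between
product states whose catalyst part is diagonal. -/
theorem ThermalTransition.fidelity_le {S : Type*} [Fintype S] [DecidableEq S] {β : ℝ}
    {HC : ℕ → ℝ} {HS : S → ℝ} (hZC : Summable fun j => Real.exp (-β * HC j))
    {ω ω' : ℕ → ℝ} (hω : IsDistribution ω) (hω' : IsDistribution ω') {ρ ρ' N N' : Matrix S S ℂ}
    (hN : N.PosSemidef) (hN' : N'.PosSemidef)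
    (hNN : N * N = (Matrix.diagonal fun s =>
      ((√(Real.exp (-β * HS s) / partitionFn β HS) : ℝ) : ℂ)) * ρ * Matrix.diagonal fun s =>
      ((√(Real.exp (-β * HS s) / partitionFn β HS) : ℝ) : ℂ))
    (hNN' : N' * N' = (Matrix.diagonal fun s =>
      ((√(Real.exp (-β * HS s) / partitionFn β HS) : ℝ) : ℂ)) * ρ' * Matrix.diagonal fun s =>
      ((√(Real.exp (-β * HS s) / partitionFn β HS) : ℝ) : ℂ))
    (hT : ThermalTransition β (totalHamiltonian HC HS) (diagonalState ω ⊗ₖ ρ)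
      (diagonalState ω' ⊗ₖ ρ')) :
    (∑' c, √(ω c * (Real.exp (-β * HC c) / partitionFn β HC))) * N.trace.re
      ≤ (∑' c, √(ω' c * (Real.exp (-β * HC c) / partitionFn β HC))) * N'.trace.re := by
  obtain ⟨B, _, _, HB, U, hZB, hU, hρ'⟩ := hT
  have hZS : Summable fun s => Real.exp (-β * HS s) := Summable.of_finite
  have hqs := (hasSum_gibbs hZC).summable
  have hps := hasSum_gibbs hZB
  refine fidelity_le_of_evolve hω.1 hω.2.summable hω'.1 (fun c => gibbs_pos hZC c) hqs
    (fun b => (gibbs_pos hZB b).le) hps (fun s => Real.sqrt_pos.2 (gibbs_pos hZS s))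
    (hω.summable_sqrt_mul (fun c => (gibbs_pos hZC c).le) hqs)
    (hω'.summable_sqrt_mul (fun c => (gibbs_pos hZC c).le) hqs) hN hN' hNN hNN' U
    (fun c s s' => ?_) (fun c s s' => ?_)
  · have h := congrFun (congrFun hρ' (c, s)) (c, s')
    rwa [Matrix.kroneckerMap_apply, diagonalState, Matrix.diagonal_apply_eq] at h
  · have : Nonempty S := ⟨s⟩
    rw [tsum_congr fun b => (hasSum_gibbs_purification (β := β) (partitionFn_pos hZC).le
      (partitionFn_pos hZS).le (partitionFn_pos hZB).le hU ((c, s), b) ((c, s'), b)).tsum_eq]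
    rcases eq_or_ne s s' with rfl | hs
    · simp only [Matrix.diagonal_apply_eq, if_true, mul_one, Complex.ofReal_mul]
      rw [tsum_mul_left, ← Complex.ofReal_tsum, hps.tsum_eq, Complex.ofReal_one, mul_one,
        Real.sq_sqrt (gibbs_pos hZS s).le]
    · simp [hs]

/-! ### Scalar estimates for the catalyst. -/

section Scalar

variable {q r r' : ℕ → ℝ}

/-- The root fidelity with a fixed distribution is Hölder continuous of order `1/2`. -/
theorem sq_tsum_sqrt_sub_le (hq : ∀ c, 0 ≤ q c) (hqs : HasSum q 1) (hr : IsDistribution r)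
    (hr' : IsDistribution r') {s : ℝ} (hs : 1 ≤ s)
    (h : s * ∑' c, √(r c * q c) ≤ ∑' c, √(r' c * q c)) :
    (s - 1) ^ 2 * (∑' c, √(r c * q c)) ^ 2 ≤ ∑' c, |r c - r' c| := by
  have h1 := hr.summable_sqrt_mul hq hqs.summable
  have h2 := hr'.summable_sqrt_mul hq hqs.summable
  have hab : Summable fun c => |r c - r' c| := (hr.2.summable.sub hr'.2.summable).abs
  -- This is √r' ≤ √r + √|r - r'|; Cauchy-Schwarz and `∑ q = 1` then bound the sum.
  have hsub : ∀ c, √(r' c * q c) - √(r c * q c) ≤ √(q c) * √|r c - r' c| := fun c => by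
    rw [Real.sqrt_mul (hr.1 c), Real.sqrt_mul (hr'.1 c), ← sub_mul, mul_comm]
    refine mul_le_mul_of_nonneg_left ?_ (Real.sqrt_nonneg _)
    rw [sub_le_iff_le_add]
    refine Real.sqrt_le_iff.2 ⟨by positivity, ?_⟩
    nlinarith [neg_abs_le (r c - r' c), Real.sq_sqrt (hr.1 c), Real.sq_sqrt (abs_nonneg (r c - r' c)),
      mul_nonneg (Real.sqrt_nonneg |r c - r' c|) (Real.sqrt_nonneg (r c))]
  obtain ⟨h3, h4⟩ := Real.summable_and_inner_le_Lp_mul_Lq_tsum_of_nonneg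
    Real.HolderConjugate.two_two (f := fun c => √(q c)) (g := fun c => √|r c - r' c|)
    (fun _ => Real.sqrt_nonneg _) (fun _ => Real.sqrt_nonneg _)
    (by simpa [Real.sq_sqrt (hq _)] using hqs.summable)
    (by simpa [Real.sq_sqrt (abs_nonneg _)] using hab)
  simp only [Real.rpow_two, Real.sq_sqrt (hq _), Real.sq_sqrt (abs_nonneg _), hqs.tsum_eq,
    ← Real.sqrt_eq_rpow, Real.sqrt_one, one_mul] at h4
  have h5 : ∑' c, √(r' c * q c) - ∑' c, √(r c * q c) ≤ √(∑' c, |r c - r' c|) := by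
    rw [← h2.tsum_sub h1]
    exact ((h2.sub h1).tsum_le_tsum hsub h3).trans h4
  have h6 : 0 ≤ ∑' c, √(r c * q c) := tsum_nonneg fun _ => Real.sqrt_nonneg _
  rw [← mul_pow]
  refine (Real.le_sqrt (mul_nonneg (by linarith) h6) (tsum_nonneg fun _ => abs_nonneg _)).1 ?_
  linarith

/-- Markov's inequality for the levels below the cutoff. -/
theorem le_sum_range_of_meanEnergyLE {EC : ℕ → ℝ} (hmono : Monotone EC) (hnn : ∀ j, 0 ≤ EC j)
    {E : ℝ} (hr : IsDistribution r) (hE : MeanEnergyLE EC r E) {W : ℝ} (hW : W < 1) {J : ℕ}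
    (hJ : E / (1 - W) < EC (J + 1)) : W ≤ ∑ j ∈ Finset.range (J + 1), r j := by
  have hE0 : 0 ≤ E := (tsum_nonneg fun j => mul_nonneg (hnn j) (hr.1 j)).trans hE.2
  have h1 := hr.2.summable.sum_add_tsum_nat_add (J + 1)
  rw [hr.2.tsum_eq] at h1
  have h2 := hE.1.sum_add_tsum_nat_add (J + 1)
  have h3 : 0 ≤ ∑ i ∈ Finset.range (J + 1), EC i * r i :=
    Finset.sum_nonneg fun j _ => mul_nonneg (hnn j) (hr.1 j)
  have h4 : EC (J + 1) * ∑' i, r (i + (J + 1)) ≤ ∑' i, EC (i + (J + 1)) * r (i + (J + 1)) := by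
    rw [← tsum_mul_left]
    refine Summable.tsum_le_tsum (fun i => ?_)
      (((summable_nat_add_iff (J + 1)).2 hr.2.summable).mul_left _)
      ((summable_nat_add_iff (f := fun j => EC j * r j) (J + 1)).2 hE.1)
    exact mul_le_mul_of_nonneg_right (hmono (by omega)) (hr.1 _)
  have h5 : EC (J + 1) * ∑' i, r (i + (J + 1)) ≤ E := by linarith [hE.2]
  have hW' : 0 < 1 - W := by linarith
  rw [div_lt_iff₀ hW'] at hJ
  -- If this energy were zero, the cutoff condition would read `E < 0`, contradicting `hE0`.
  have hpos : 0 < EC (J + 1) := by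
    rcases (hnn (J + 1)).lt_or_eq with h | h
    · exact h
    · rw [← h] at hJ; linarith
  have : EC (J + 1) * ∑' i, r (i + (J + 1)) < EC (J + 1) * (1 - W) := h5.trans_lt hJ
  have := lt_of_mul_lt_mul_left this hpos.le
  linarith

/-- Unbounded energies make the set nonempty; otherwise `sInf` would return the meaningless default
`0`. -/
theorem cutoffLevel_spec {EC : ℕ → ℝ} (hEC : Filter.Tendsto EC Filter.atTop Filter.atTop)
    (E W : ℝ) : E / (1 - W) < EC (cutoffLevel EC E W + 1) := by
  have h : {j : ℕ | E / (1 - W) < EC (j + 1)}.Nonempty := by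
    obtain ⟨j, hj⟩ := (((Filter.tendsto_add_atTop_iff_nat 1).2 hEC).eventually
      (Filter.eventually_gt_atTop (E / (1 - W)))).exists
    exact ⟨j, hj⟩
  exact Nat.sInf_mem h

theorem tendsto_atTop_of_summable_exp {β : ℝ} (hβ : 0 < β) {EC : ℕ → ℝ}
    (h : Summable fun j => Real.exp (-β * EC j)) : Filter.Tendsto EC Filter.atTop Filter.atTop := by
  have h1 := Real.tendsto_exp_comp_nhds_zero.1 h.tendsto_atTop_zero
  have h2 := h1.const_mul_atBot_of_neg (neg_neg_of_pos (inv_pos.2 hβ))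
  refine h2.congr fun j => ?_
  field_simp

theorem epsC_mul_rpow_le_one {β : ℝ} (hβ : 0 < β) {EC : ℕ → ℝ} (hnn : ∀ j, 0 ≤ EC j) {E W : ℝ}
    (hW : W ∈ Set.Ioo (0 : ℝ) 1) : W * Real.exp (-β / 2) ^ EC (cutoffLevel EC E W) ≤ 1 := by
  have h := Real.rpow_le_one (Real.exp_pos (-β / 2)).le
    (Real.exp_le_one_iff.2 (by linarith)) (hnn (cutoffLevel EC E W))
  have h' := Real.rpow_nonneg (Real.exp_pos (-β / 2)).le (EC (cutoffLevel EC E W))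
  nlinarith [hW.1, hW.2]

/-- The value at W = 1/2 is already positive. Boundedness above is needed too, since `sSup` of an
unbounded set of reals is `0`. -/
theorem epsC_pos {β : ℝ} (hβ : 0 < β) {EC : ℕ → ℝ} (hnn : ∀ j, 0 ≤ EC j) (E : ℝ) :
    0 < epsC β EC E := by
  have hW : (1 / 2 : ℝ) ∈ Set.Ioo (0 : ℝ) 1 := by norm_num
  refine lt_of_lt_of_le ?_ (le_csSup ⟨1, ?_⟩ (Set.mem_image_of_mem _ hW))
  · exact mul_pos (by norm_num) (Real.rpow_pos_of_pos (Real.exp_pos _) _)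
  · rintro _ ⟨W, hW, rfl⟩
    exact epsC_mul_rpow_le_one hβ hnn hW

/-- A state of bounded mean energy has root fidelity at least `ε_C / √Z_C` with the thermal
state. -/
theorem epsC_le_tsum_sqrt {β : ℝ} (hβ : 0 < β) {EC : ℕ → ℝ} (hmono : Monotone EC)
    (hnn : ∀ j, 0 ≤ EC j) (hZC : Summable fun j => Real.exp (-β * EC j)) {E : ℝ}
    (hr : IsDistribution r) (hE : MeanEnergyLE EC r E) :
    epsC β EC E / √(partitionFn β EC)
      ≤ ∑' c, √(r c * (Real.exp (-β * EC c) / partitionFn β EC)) := by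
  have hZ := partitionFn_pos hZC
  have hsZ := Real.sqrt_pos.2 hZ
  rw [div_le_iff₀ hsZ]
  refine csSup_le ((Set.nonempty_Ioo.2 zero_lt_one).image _) ?_
  rintro _ ⟨W, hW, rfl⟩
  rw [← div_le_iff₀ hsZ]
  set J := cutoffLevel EC E W with hJ
  have hWJ := le_sum_range_of_meanEnergyLE hmono hnn hr hE hW.2
    (cutoffLevel_spec (tendsto_atTop_of_summable_exp hβ hZC) E W)
  have hs := hr.summable_sqrt_mul (fun c => (gibbs_pos hZC c).le) (hasSum_gibbs hZC).summable
  refine le_trans ?_ (hs.sum_le_tsum (Finset.range (J + 1)) fun _ _ => Real.sqrt_nonneg _)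
  have hg : 0 ≤ Real.exp (-β / 2) ^ EC J / √(partitionFn β EC) :=
    div_nonneg (Real.rpow_nonneg (Real.exp_pos _).le _) hsZ.le
  dsimp only
  rw [mul_div_assoc]
  refine (mul_le_mul_of_nonneg_right hWJ hg).trans ?_
  rw [Finset.sum_mul]
  refine Finset.sum_le_sum fun j hj => ?_
  have hr1 : r j ≤ 1 := by
    rw [← hr.2.tsum_eq]
    exact hr.2.summable.le_tsum j fun i _ => hr.1 i
  rw [Real.sqrt_mul (hr.1 j), Real.sqrt_div (Real.exp_pos _).le]
  -- Two comparisons: `r j ≤ √(r j)` because `r j ≤ 1`, and each level `j ≤ J` has Boltzmann factor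
  -- at least that of level `J`.
  refine mul_le_mul ?_ ?_ hg (Real.sqrt_nonneg _)
  · exact Real.le_sqrt_of_sq_le (by nlinarith [hr.1 j])
  · refine div_le_div_of_nonneg_right ?_ hsZ.le
    rw [← Real.exp_mul, Real.sqrt_eq_rpow, ← Real.exp_mul, Real.exp_le_exp]
    have := hmono (Nat.lt_succ_iff.1 (Finset.mem_range.1 hj))
    nlinarith

theorem splitConst_pos {a : ℝ} (ha : 0 < a) : 0 < splitConst a := by
  unfold splitConst; positivity

/-- Clearing denominators gives s⁴(3 - 2s) ≤ 2(s - 1). The left side is nonpositive for s ≥ 3/2, and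
on [√2, 3/2] the inequality holds with little slack, so √2 is bounded below by 1.414. Here κ₂ ≥ 1 is
used quantitatively. -/
theorem splitConst_sq_le {s : ℝ} (hs0 : 0 ≤ s) (hs : 2 ≤ s ^ 2) : splitConst (s ^ 2) ≤ s - 1 := by
  have h1 : (1.414 : ℝ) ≤ s := by nlinarith
  have h2 : s ^ 2 * s ^ 2 * (3 - 2 * s) ≤ 2 * (s - 1) := by
    rcases le_total s 1.5 with h | h
    · have : s ^ 2 ≤ 2.25 := by nlinarith
      have h3 : s ^ 2 * s ^ 2 ≤ 2.25 * s ^ 2 := by nlinarith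
      nlinarith [mul_nonneg (sub_nonneg.2 h1) (sub_nonneg.2 h)]
    · nlinarith [mul_nonneg (sq_nonneg (s ^ 2)) (by linarith : (0 : ℝ) ≤ 2 * s - 3)]
  unfold splitConst
  rw [mul_div_assoc', div_le_iff₀ (by positivity)]
  nlinarith

end Scalar

/-! ### From the Rényi divergence to the final bound. -/

/-- `√D ρ √D` has a square root `N` with `tr N` the root fidelity of `ρ` and the thermal state
`D`. -/
theorem exists_sqrt_renyiHalf {S : Type*} [Fintype S] [DecidableEq S] {β : ℝ} {HS : S → ℝ}
    {ρ : Matrix S S ℂ} (hρ : IsDensityMatrix ρ) :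
    ∃ N : Matrix S S ℂ, N.PosSemidef ∧ 0 < N.trace.re ∧
      renyiHalf ρ (thermalState β HS) = -2 * Real.logb 2 N.trace.re ∧
      N * N = (Matrix.diagonal fun s =>
        ((√(Real.exp (-β * HS s) / partitionFn β HS) : ℝ) : ℂ)) * ρ * Matrix.diagonal fun s =>
        ((√(Real.exp (-β * HS s) / partitionFn β HS) : ℝ) : ℂ) := by
  have hZS : Summable fun s => Real.exp (-β * HS s) := Summable.of_finite
  set D : Matrix S S ℂ := Matrix.diagonal fun s =>
    ((√(Real.exp (-β * HS s) / partitionFn β HS) : ℝ) : ℂ) with hD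
  have hDH : Matrix.conjTranspose D = D := by
    rw [hD, Matrix.diagonal_conjTranspose]; congr 1; funext s; simp
  have hDD : D * D = thermalState β HS := by
    rw [hD, Matrix.diagonal_mul_diagonal, thermalState]
    congr 1; funext s
    exact_mod_cast Real.mul_self_sqrt (gibbs_pos hZS s).le
  have hK : CFC.sqrt ρ * CFC.sqrt ρ = ρ := CFC.sqrt_mul_sqrt_self ρ hρ.1.nonneg
  have hKH : Matrix.conjTranspose (CFC.sqrt ρ) = CFC.sqrt ρ :=
    (Matrix.nonneg_iff_posSemidef.1 (CFC.sqrt_nonneg ρ)).isHermitian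
  -- With `X = D * √ρ`, the divergence involves `Xᴴ * X` while `N` is the root of `X * Xᴴ`; the two
  -- have equal eigenvalues.
  have e1 : Matrix.conjTranspose (D * CFC.sqrt ρ) * (D * CFC.sqrt ρ)
      = CFC.sqrt ρ * thermalState β HS * CFC.sqrt ρ := by
    rw [Matrix.conjTranspose_mul, hKH, hDH, ← hDD]; simp only [mul_assoc]
  have e2 : (D * CFC.sqrt ρ) * Matrix.conjTranspose (D * CFC.sqrt ρ) = D * ρ * D := by
    rw [Matrix.conjTranspose_mul, hKH, hDH]
    conv_rhs => rw [← hK]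
    simp only [mul_assoc]
  have hpsd : (D * ρ * D).PosSemidef := e2 ▸ Matrix.posSemidef_self_mul_conjTranspose _
  have hN : (CFC.sqrt (D * ρ * D)).PosSemidef :=
    Matrix.nonneg_iff_posSemidef.1 (CFC.sqrt_nonneg _)
  have hNN : CFC.sqrt (D * ρ * D) * CFC.sqrt (D * ρ * D) = D * ρ * D :=
    CFC.sqrt_mul_sqrt_self _ hpsd.nonneg
  refine ⟨CFC.sqrt (D * ρ * D), hN, ?_, ?_, hNN⟩
  · obtain ⟨h1, h2⟩ := Complex.le_def.1 hN.trace_nonneg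
    -- Vanishing trace would give `N = 0`, hence `ρ = 0` because `D` is invertible, against `tr ρ =
    -- 1`.
    refine lt_of_le_of_ne h1 fun h => ?_
    have h0 := hN.trace_eq_zero_iff.1 (Complex.ext h.symm h2.symm)
    have hρ0 := (Matrix.eq_mul_conjTranspose_of_sq_eq
      (fun s => Real.sqrt_pos.2 (gibbs_pos hZS s)) hN hNN).1
    rw [h0, mul_zero, zero_mul] at hρ0
    have := hρ.2
    rw [hρ0, Matrix.trace_zero] at this
    exact zero_ne_one this
  · rw [renyiHalf, ← e1, Matrix.trace_sqrt_conjTranspose_mul_self, e2]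

theorem mainTheorem5 (β : ℝ) (hβ : 0 < β)
    (m : ℕ) (ES : Fin m → ℝ)
    (EC : ℕ → ℝ) (hECmono : Monotone EC) (hECnonneg : ∀ j, 0 ≤ EC j)
    (hZC : Summable fun j => Real.exp (-β * EC j))
    (E : ℝ)
    (ρS ρS' : Matrix (Fin m) (Fin m) ℂ) (hρS : IsDensityMatrix ρS) (hρS' : IsDensityMatrix ρS')
    (hκ : 1 ≤ kappaTwo β ES ρS ρS') :
    0 < embezzlingBound β ES EC E ρS ρS' ∧
    ∀ ω ω' : ℕ → ℝ, IsDistribution ω → IsDistribution ω' → MeanEnergyLE EC ω E →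
      ThermalTransition β (totalHamiltonian EC ES)
        (diagonalState ω ⊗ₖ ρS) (diagonalState ω' ⊗ₖ ρS') →
      embezzlingBound β ES EC E ρS ρS' ≤ diagonalTraceDist ω ω' := by
  have hZ := partitionFn_pos hZC
  have hε := epsC_pos hβ hECnonneg E
  have hf : 0 < splitConst ((2 : ℝ) ^ kappaTwo β ES ρS ρS') :=
    splitConst_pos (Real.rpow_pos_of_pos two_pos _)
  refine ⟨by unfold embezzlingBound; positivity, fun ω ω' hω hω' hE hT => ?_⟩
  obtain ⟨N, hN, hNpos, hren, hNN⟩ := exists_sqrt_renyiHalf (β := β) (HS := ES) hρS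
  obtain ⟨N', hN', hNpos', hren', hNN'⟩ := exists_sqrt_renyiHalf (β := β) (HS := ES) hρS'
  have hF := hT.fidelity_le hZC hω hω' hN hN' hNN hNN'
  set s := N.trace.re / N'.trace.re with hs
  have hs0 : 0 < s := div_pos hNpos hNpos'
  have hs2 : (2 : ℝ) ^ kappaTwo β ES ρS ρS' = s ^ 2 := by
    rw [kappaTwo, hren, hren', show -2 * Real.logb 2 N'.trace.re - -2 * Real.logb 2 N.trace.re
      = Real.logb 2 s * 2 by rw [hs, Real.logb_div hNpos.ne' hNpos'.ne']; ring,
      Real.rpow_mul two_pos.le, Real.rpow_logb two_pos (by norm_num) hs0, Real.rpow_two]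
  have hs2' : 2 ≤ s ^ 2 := by
    rw [← hs2]
    simpa using Real.rpow_le_rpow_of_exponent_le one_le_two hκ
  have hs1 : 1 ≤ s := by nlinarith
  have hle := sq_tsum_sqrt_sub_le (fun c => (gibbs_pos hZC c).le) (hasSum_gibbs hZC) hω hω' hs1
    (by rw [hs, div_mul_eq_mul_div, div_le_iff₀ hNpos', mul_comm]; exact hF)
  have hsplit := splitConst_sq_le hs0.le hs2'
  have hFε := epsC_le_tsum_sqrt hβ hECmono hECnonneg hZC hω hE
  rw [hs2] at hf
  rw [embezzlingBound, diagonalTraceDist, hs2]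
  refine mul_le_mul_of_nonneg_left (le_trans ?_ hle) (by norm_num)
  -- The bound is regrouped as `f² * (ε_C / √Z_C)²`, to be compared factor by factor with `(s - 1)²`
  -- and the squared root fidelity of `ω`.
  rw [mul_div_assoc, ← Real.sq_sqrt hZ.le, ← div_pow, Real.sq_sqrt hZ.le]
  gcongr
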